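/- **Setting.** Let $\Delta$ be a quantifier-free formula of linear real arithmetic over real variables $X_1,\dots,X_n$, in conjunctive normal form, each clause containing at most two variables (literals are possibly negated linear atoms $\sum_i a_iX_i\le b$ or $\sum_i a_iX_i=b$). Let $p=\prod_{i}p_i(x_i)\prod_{\{i,j\}\in\mathcal E_p}p_{ij}(x_i,x_j)$ with all factors in $\mathcal W_{\mathsf{PEP}}$: each $p_S$ is given by finitely many pieces $(\Phi_k,(q_k^s)_{s\in S})$, where the $\Phi_k$ are pairwise disjoint conjunctions of literals over $x_S$ and the $q^s_k$ are univariate real polynomials, and it equals $\prod_{s\in S}\exp(q_k^s(x_s))$ where $\Phi_k$ holds and $0$ outside all pieces. Let $\Delta_S$ be the conjunction of the clauses of $\Delta$ with variables exactly $S$ (clauses without variables, if any, are added to every univariate $\Delta_i$), and $f_S=[\![x_S\models\Delta_S]\!]\,p_S$; missing $\Delta_S$, $p_S$ are True and $1$. The global graph $\mathcal G$ joins $X_i,X_j$ when some clause of $\Delta$ has exactly the variables $X_i,X_j$ or some weight $p_{ij}$ is given. Assume that $\mathcal G$ has treewidth one, i.e. it is a forest with at least one edge. **Parameters.** $d\ge1$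 is the diameter of $\mathcal G$ (for a forest, the largest diameter of its trees); $c\ge 1$ bounds the number of literals (with multiplicity) of every $\Delta_S'=\Delta_S\wedge\bigvee_k\Phi_k$, where $S$ is a single variable or an edge of $\mathcal G$ and the $\Phi_k$ are the piece conditions of $p_S$; $q_{\max}\ge1$ bounds the degrees of all polynomials $q_k^s$. **Algorithm.** Root each tree of $\mathcal G$ at an arbitrary vertex. From the leaves to the roots, $\textsc{MpMap}$ computes the univariate piecewise exponentiated polynomials $$m_{X_i}(x_i)=f_i(x_i)\prod_{k\in\mathrm{child}(i)}m_{f_{ki}\to X_i}(x_i),\qquad m_{f_{ij}\to X_j}(x_j)=\sup_{x_i}f_{ij}(x_i,x_j)\,m_{X_i}(x_i)\quad(j\text{ the parent of }i),$$ each represented by an ordered list of pieces (an interval and the polynomial in the exponent). Products are formed by intersecting pieces. A message $m_{f_{ij}\to X_j}$ is formed as follows. (1) Split the $x_j$-line at its critical points: the values given by the literals of $\Delta_{ij}'$ on $X_j$ alone, and the crossings of the lines $x_i=\alpha x_j+\beta$ given by the other literals and by the overall bounds of $m_{X_i}$. (2) On each resulting interval, these lines cut the $x_i$-range into strips with affine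 (or infinite) bounds; for each strip on which $\Delta_{ij}$ and some $\Phi_k$ hold, compute $\exp(q^j_k(x_j))\cdot\sup_{x_i\in[l(x_j),u(x_j)]}\exp(q^i_k(x_i))\,m_{X_i}(x_i)$ (with strict bounds for a strip lying strictly between two lines). This supremum is computed in log-space for a piecewise polynomial $g$ by splitting the $x_j$-line at the preimages under $l,u$ of the break points and extreme points of $g$, at the zeros of $g\circ u-g\circ l$ and at the crossing of $l$ and $u$; on each interval so obtained the supremum is the maximum of a constant and of $g\circ l$ or $g\circ u$, which gives at most one further break; redundant pieces are then merged. (3) Take the pointwise maximum over the strips, splitting at the ends of pieces and, between these, at the intersections of the exponents. (A supremum that is infinite is recorded as a piece with value $+\infty$.) **Theorem.** There is an absolute constant $C$ such that, for every such problem and every choice of roots, the total number of pieces of all messages generated by $\textsc{MpMap}$ (those sent by the univariate factors $f_i$, by the bivariate factors $f_{ij}$, and by the variables, including the final messages at the roots) is at most $$C\; d\; c^{5d+1}\,(2n)^{d+1}\,q_{\max}^{2d},$$ i.e. it is $\mathcal O\big(d\,c^{5d+1}(2n)^{d+1}q_{\max}^{2d}\big)$. -/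

import Mathlib

noncomputable section

namespace MpMap

open scoped Classical

/-! ### Linear real arithmetic formulas over the variables `X_0, …, X_{n-1}` -/

/-- The linear atom `∑ i, coeff i * X i ≤ rhs` (or `= rhs` when `isEq`). -/
structure Atom (n : ℕ) where
  coeff : Fin n → ℝ
  rhs : ℝ
  isEq : Bool

/-- Truth of an atom at an assignment. -/
def Atom.Holds {n : ℕ} (a : Atom n) (x : Fin n → ℝ) : Prop :=
  if a.isEq then ∑ i, a.coeff i * x i = a.rhs else ∑ i, a.coeff i * x i ≤ a.rhs

/-- The variables that occur in an atom. -/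
def Atom.vars {n : ℕ} (a : Atom n) : Finset (Fin n) :=
  Finset.univ.filter fun i => a.coeff i ≠ 0

/-- A literal: an atom (`pos = true`) or a negated atom (`pos = false`). -/
structure Literal (n : ℕ) where
  atom : Atom n
  pos : Bool

/-- Truth of a literal at an assignment. -/
def Literal.Holds {n : ℕ} (l : Literal n) (x : Fin n → ℝ) : Prop :=
  if l.pos then l.atom.Holds x else ¬ l.atom.Holds x

/-- The variables of a list of literals. -/
def litVars {n : ℕ} (ls : List (Literal n)) : Finset (Fin n) :=
  ls.foldr (fun l s => l.atom.vars ∪ s) ∅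

/-! ### Weights: piecewise exponentiated polynomials -/

/-- One piece of a weight with scope `S`: on the polytope given by the conjunction `guard`, the
weight is `∏ s ∈ S, exp (expo s (x s))`. -/
structure WeightPiece (n : ℕ) where
  guard : List (Literal n)
  expo : Fin n → Polynomial ℝ

/-- The guard of a piece holds. -/
def WeightPiece.Active {n : ℕ} (w : WeightPiece n) (x : Fin n → ℝ) : Prop :=
  ∀ l ∈ w.guard, l.Holds x

/-- A constrained MAP problem: a formula `Δ` in conjunctive normal form (a list of clauses, each a
list of literals) with at most bivariate clauses, and a density that is the product of the weights
`p S` over scopes `S` of one or two variables, each a piecewise exponentiated polynomial.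
`p S = none` means that no weight is given for the scope `S`, i.e. that it is `1`. -/
structure Problem (n : ℕ) where
  Δ : List (List (Literal n))
  p : Finset (Fin n) → Option (List (WeightPiece n))
  clause_vars : ∀ cl ∈ Δ, (litVars cl).card ≤ 2
  scope_card : ∀ S w, p S = some w → S.card = 1 ∨ S.card = 2
  guard_vars : ∀ S w, p S = some w → ∀ P ∈ w, litVars P.guard ⊆ S
  guard_disjoint : ∀ S w, p S = some w →
    w.Pairwise fun P P' => ¬ ∃ x : Fin n → ℝ, P.Active x ∧ P'.Active x

namespace Problem

variable {n : ℕ}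

/-- The global graph: `i` and `j` are adjacent when a bivariate clause or a bivariate weight
has exactly the variables `i, j`. -/
def graph (P : Problem n) : SimpleGraph (Fin n) where
  Adj i j := i ≠ j ∧ ((∃ cl ∈ P.Δ, litVars cl = {i, j}) ∨ (P.p {i, j}).isSome)
  symm := ⟨fun i j h => ⟨h.1.symm, by rw [Finset.pair_comm]; exact h.2⟩⟩
  loopless := ⟨fun _ h => h.1 rfl⟩

/-- `Δ_S`: the clauses with variable set `S` (clauses without variables are put in every
univariate `Δ_i`). -/
def clausesOn (P : Problem n) (S : Finset (Fin n)) : List (List (Literal n)) :=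
  P.Δ.filter fun cl => litVars cl = S ∨ (S.card = 1 ∧ litVars cl = ∅)

/-- `p_S`, with the default `1`. -/
def weightOn (P : Problem n) (S : Finset (Fin n)) : List (WeightPiece n) :=
  (P.p S).getD [⟨[], fun _ => 0⟩]

/-- The literals of `Δ_S' = Δ_S ∧ ⋁ k, φ_k`, where the `φ_k` are the guards of `p_S`. -/
def litsOn (P : Problem n) (S : Finset (Fin n)) : List (Literal n) :=
  (P.clausesOn S).flatten ++ (P.weightOn S).flatMap WeightPiece.guard

/-- The size of `Δ_S'`: its number of literals. -/
def size (P : Problem n) (S : Finset (Fin n)) : ℕ := (P.litsOn S).length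

/-- If `x` satisfies `Δ_S'`, the piece of `p_S` that is active at `x`; otherwise `none`. -/
def activePiece (P : Problem n) (S : Finset (Fin n)) (x : Fin n → ℝ) : Option (WeightPiece n) :=
  if ∀ cl ∈ P.clausesOn S, ∃ l ∈ cl, l.Holds x then (P.weightOn S).find? fun w => w.Active x
  else none

/-- `c` bounds the sizes of all `Δ_i'` and of all `Δ_ij'` along the edges of the global graph. -/
def SizeLE (P : Problem n) (c : ℕ) : Prop :=
  (∀ i, P.size {i} ≤ c) ∧ ∀ i j, P.graph.Adj i j → P.size {i, j} ≤ c

/-- `q` bounds the degrees of all univariate polynomials in the exponents of the weights. -/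
def DegLE (P : Problem n) (q : ℕ) : Prop :=
  ∀ S w, P.p S = some w → ∀ Q ∈ w, ∀ s ∈ S, (Q.expo s).natDegree ≤ q

end Problem

/-! ### Intervals -/

/-- An interval of real numbers with possibly infinite endpoints, each open or closed. -/
structure Ivl where
  lo : EReal
  hi : EReal
  loClosed : Bool
  hiClosed : Bool

namespace Ivl

/-- The points of an interval. -/
def toSet (I : Ivl) : Set ℝ :=
  {x | (if I.loClosed then I.lo ≤ (x : EReal) else I.lo < (x : EReal)) ∧
       (if I.hiClosed then (x : EReal) ≤ I.hi else (x : EReal) < I.hi)}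

/-- The intersection of two intervals. -/
def inter (I J : Ivl) : Ivl where
  lo := max I.lo J.lo
  hi := min I.hi J.hi
  loClosed :=
    if I.lo < J.lo then J.loClosed else if J.lo < I.lo then I.loClosed
    else I.loClosed && J.loClosed
  hiClosed :=
    if I.hi < J.hi then I.hiClosed else if J.hi < I.hi then J.hiClosed
    else I.hiClosed && J.hiClosed

/-- The real line. -/
def univ : Ivl := ⟨⊥, ⊤, false, false⟩

/-- Some point of a nonempty interval. -/
def sample (I : Ivl) : ℝ := Classical.epsilon fun x => x ∈ I.toSet

/-- `I` ends no later than `J`. -/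
def EndsBefore (I J : Ivl) : Prop :=
  I.hi < J.hi ∨ (I.hi = J.hi ∧ (I.hiClosed = true → J.hiClosed = true))

end Ivl

/-- The finite endpoint `e` as a real number (nothing if `e` is infinite). -/
def finitePart (e : EReal) : List ℝ :=
  if e = ⊥ ∨ e = ⊤ then [] else [e.toReal]

/-- For `a < b₁ < b₂ < …`: the intervals `(a, b₁), {b₁}, (b₁, b₂), {b₂}, …, (b_k, ∞)`. -/
def cellsFrom : EReal → List ℝ → List Ivl
  | a, [] => [⟨a, ⊤, false, false⟩]
  | a, b :: t => ⟨a, b, false, false⟩ :: ⟨b, b, true, true⟩ :: cellsFrom b t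

/-- The partition of the real line into a finite set of points and the open intervals between
them, from left to right. -/
def cells (B : List ℝ) : List Ivl :=
  cellsFrom ⊥ (B.toFinset.sort (· ≤ ·))

/-! ### Univariate piecewise exponentiated polynomials

They are stored through their logarithms: on each piece the exponent is a polynomial, or `top`
when a supremum over an unbounded range is infinite.  Outside the pieces the function is `0`, with
logarithm `⊥`. -/

/-- The exponent of a piece. -/
inductive Expo where
  | top : Expo
  | poly : Polynomial ℝ → Expo

namespace Expo

/-- The value of an exponent at a point. -/
def eval : Expo → ℝ → EReal
  | top, _ => ⊤
  | poly p, x => ((p.eval x : ℝ) : EReal)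

/-- Sum of exponents (product of the exponentials). -/
def sum : Expo → Expo → Expo
  | poly p, poly q => poly (p + q)
  | _, _ => top

/-- Substitution `x = a * y + b`. -/
def compAffine (a b : ℝ) : Expo → Expo
  | top => top
  | poly p => poly (p.comp (Polynomial.C a * Polynomial.X + Polynomial.C b))

/-- The points where two different polynomials agree. -/
def agree : Expo → Expo → Finset ℝ
  | poly p, poly q => (p - q).roots.toFinset
  | _, _ => ∅

/-- The zeros of the derivative of a nonconstant polynomial. -/
def critical : Expo → Finset ℝ
  | top => ∅
  | poly p => p.derivative.roots.toFinset

/-- The constant with the given value (`none` for `⊥`). -/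
def ofValue (v : EReal) : Option Expo :=
  if v = ⊥ then none else if v = ⊤ then some top else some (poly (Polynomial.C v.toReal))

/-- The exponent with the larger value at `y`; `none` stands for `⊥`. -/
def dominating (y : ℝ) : Option Expo → Option Expo → Option Expo
  | none, b => b
  | a, none => a
  | some a, some b => if b.eval y ≤ a.eval y then some a else some b

end Expo

/-- A piece: an interval together with an exponent. -/
structure Piece where
  dom : Ivl
  expo : Expo

/-- A piecewise function: its pieces, pairwise disjoint and ordered from left to right.  Its number
of pieces is the length of the list. -/
abbrev PW := List Piece

/-- The limit superior at `b` from the left (for `b = ⊤`: at `∞`). -/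
def leftLim (g : ℝ → EReal) (b : EReal) : EReal :=
  Filter.limsup g (Filter.comap (fun x : ℝ => (x : EReal)) (nhdsWithin b (Set.Iio b)))

/-- The limit superior at `b` from the right (for `b = ⊥`: at `-∞`). -/
def rightLim (g : ℝ → EReal) (b : EReal) : EReal :=
  Filter.limsup g (Filter.comap (fun x : ℝ => (x : EReal)) (nhdsWithin b (Set.Ioi b)))

namespace PW

/-- The exponent of the piece that contains `x`. -/
def expoAt (f : PW) (x : ℝ) : Option Expo :=
  (f.find? fun P => x ∈ P.dom.toSet).map Piece.expo

/-- The logarithm of the function at `x`. -/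
def logVal (f : PW) (x : ℝ) : EReal :=
  match f.expoAt x with
  | none => ⊥
  | some e => e.eval x

/-- The overlaps of the pieces of two piecewise functions, found by one sweep from left to right. -/
def overlay : PW → PW → List (Ivl × Expo × Expo)
  | [], _ => []
  | _ :: _, [] => []
  | P :: f, Q :: g =>
    let rest := if P.dom.EndsBefore Q.dom then overlay f (Q :: g) else overlay (P :: f) g
    if (P.dom.inter Q.dom).toSet.Nonempty then (P.dom.inter Q.dom, P.expo, Q.expo) :: rest
    else rest
  termination_by f g => f.length + g.length

/-- The pointwise product of two piecewise functions. -/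
def mul (f g : PW) : PW :=
  (overlay f g).map fun t => ⟨t.1, t.2.1.sum t.2.2⟩

/-- The product with `exp p` for a polynomial `p`. -/
def mulExp (p : Polynomial ℝ) (f : PW) : PW :=
  f.map fun P => ⟨P.dom, P.expo.sum (.poly p)⟩

/-- The restriction to an interval. -/
def restrict (I : Ivl) (f : PW) : PW :=
  f.filterMap fun P =>
    if (P.dom.inter I).toSet.Nonempty then some ⟨P.dom.inter I, P.expo⟩ else none

/-- Replaces the value at each point by the limit from the right. -/
def rightGerm (f : PW) : PW :=
  (f.filter fun P => P.dom.lo < P.dom.hi).map fun P =>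
    ⟨⟨P.dom.lo, P.dom.hi, true, false⟩, P.expo⟩

/-- Replaces the value at each point by the limit from the left. -/
def leftGerm (f : PW) : PW :=
  (f.filter fun P => P.dom.lo < P.dom.hi).map fun P =>
    ⟨⟨P.dom.lo, P.dom.hi, false, true⟩, P.expo⟩

/-- `B_q ∪ E_q`: the (possibly infinite) endpoints of the pieces, and the critical points of the
polynomials inside the pieces. -/
def breaksAndExtrema (f : PW) : List EReal :=
  f.flatMap fun P => P.dom.lo :: P.dom.hi ::
    (P.expo.critical.filter fun x => x ∈ P.dom.toSet).toList.map fun x => (x : EReal)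

/-- If two consecutive pieces are adjacent and one polynomial describes the function on both of
them, the piece that replaces both. -/
def join (P Q : Piece) : Option Piece :=
  let D : Ivl := ⟨P.dom.lo, Q.dom.hi, P.dom.loClosed, Q.dom.hiClosed⟩
  if P.dom.hi = Q.dom.lo ∧ P.dom.hiClosed ≠ Q.dom.loClosed then
    if P.expo = Q.expo then some ⟨D, P.expo⟩
    else if P.expo.eval P.dom.hi.toReal = Q.expo.eval P.dom.hi.toReal then
      if Q.dom.lo = Q.dom.hi then some ⟨D, P.expo⟩
      else if P.dom.lo = P.dom.hi then some ⟨D, Q.expo⟩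
      else none
    else none
  else none

/-- Auxiliary recursion for `simplify`; `P` is the last piece so far. -/
def simplifyFrom (P : Piece) : PW → PW
  | [] => [P]
  | Q :: f => match join P Q with
    | some R => simplifyFrom R f
    | none => P :: simplifyFrom Q f

/-- Removes redundant pieces. -/
def simplify : PW → PW
  | [] => []
  | P :: f => simplifyFrom P f

end PW

/-! ### Symbolic maximization between affine bounds -/

/-- An affine bound `y ↦ a * y + b`, or an infinite one. -/
inductive Bound where
  | negInf : Bound
  | posInf : Bound
  | affine (a b : ℝ) : Bound

namespace Bound

/-- The value of a bound. -/
def eval : Bound → ℝ → EReal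
  | negInf, _ => ⊥
  | posInf, _ => ⊤
  | affine a b, y => ((a * y + b : ℝ) : EReal)

/-- The preimage of `v` under a nonconstant bound. -/
def preimage : Bound → EReal → List ℝ
  | affine a b, v =>
    if a = 0 then [] else (finitePart v).map fun x => (x - b) / a
  | _, _ => []

/-- The crossing point of two affine bounds that are not parallel. -/
def crossing : Bound → Bound → List ℝ
  | affine a b, affine a' b' =>
    if a = a' then [] else [(b' - b) / (a - a')]
  | _, _ => []

end Bound

/-- The composition `f ∘ l` of a piecewise function with a bound; undefined if `l` is infinite. -/
def PW.comp (f : PW) : Bound → PW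
  | .affine a b =>
    if a = 0 then
      match Expo.ofValue (f.logVal b) with
      | none => []
      | some e => [⟨Ivl.univ, e⟩]
    else
      let g : EReal → EReal := fun v => (v - (b : EReal)) / (a : EReal)
      if 0 < a then
        f.map fun P => ⟨⟨g P.dom.lo, g P.dom.hi, P.dom.loClosed, P.dom.hiClosed⟩,
          P.expo.compAffine a b⟩
      else
        f.reverse.map fun P => ⟨⟨g P.dom.hi, g P.dom.lo, P.dom.hiClosed, P.dom.loClosed⟩,
          P.expo.compAffine a b⟩
  | _ => []

/-- A strip `l y ≤ x ≤ u y`, or `l y < x < u y` if `strict`. -/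
structure Strip where
  l : Bound
  u : Bound
  strict : Bool

/-- The points of a strip over `y`. -/
def Strip.fiber (s : Strip) (y : ℝ) : Set ℝ :=
  {x | if s.strict then s.l.eval y < (x : EReal) ∧ (x : EReal) < s.u.eval y
    else s.l.eval y ≤ (x : EReal) ∧ (x : EReal) ≤ s.u.eval y}

/-- `q ∘ l`, where for a strict bound only the values of `q` inside the strip count. -/
def lowerComp (q : PW) (s : Strip) : PW := (if s.strict then q.rightGerm else q).comp s.l

/-- `q ∘ u`, where for a strict bound only the values of `q` inside the strip count. -/
def upperComp (q : PW) (s : Strip) : PW := (if s.strict then q.leftGerm else q).comp s.u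

/-- `C_ê ∪ C_switch ∪ C_bounds`: the preimages of break points and extreme points of `q` under the
bounds, the zeros of `q ∘ u - q ∘ l`, and the crossing point of the bounds. -/
def breakPoints (q : PW) (s : Strip) : List ℝ :=
  ((q.breaksAndExtrema.flatMap fun v => s.l.preimage v ++ s.u.preimage v) ++
    ((PW.overlay (upperComp q s) (lowerComp q s)).flatMap fun t =>
      ((t.2.1.agree t.2.2).filter fun y => y ∈ t.1.toSet).toList)).filter
      (fun y => s.l.eval y ≤ s.u.eval y) ++
    s.l.crossing s.u

/-- `ê`: the largest value or one-sided limit of `q` at its break points and extreme points, taken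
from within the strip over `y`. -/
def innerMax (q : PW) (s : Strip) (y : ℝ) : EReal :=
  (q.breaksAndExtrema.map fun b =>
    max (if ∃ x ∈ s.fiber y, (x : EReal) = b then q.logVal b.toReal else ⊥)
      (max (if s.l.eval y < b ∧ b ≤ s.u.eval y then leftLim q.logVal b else ⊥)
        (if s.l.eval y ≤ b ∧ b < s.u.eval y then rightLim q.logVal b else ⊥))).foldr max ⊥

/-- The constant piece with value `v` (none for `v = ⊥`). -/
def constPiece (I : Ivl) (v : EReal) : PW :=
  match Expo.ofValue v with
  | none => []
  | some e => [⟨I, e⟩]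

/-- The pieces of `y ↦ sup_{x in the strip over y} q x` on an interval `I` spanned by break points:
there the supremum is the maximum of a constant `ê` and of a monotone `q̂`, which is `q ∘ l` or
`q ∘ u`. -/
def maxOutOn (q : PW) (s : Strip) (I : Ivl) : PW :=
  if (s.fiber I.sample).Nonempty then
    let qhat := Expo.dominating I.sample
      ((lowerComp q s).expoAt I.sample) ((upperComp q s).expoAt I.sample)
    let ehat := innerMax q s I.sample
    match qhat with
    | none => constPiece I ehat
    | some e =>
      if I.lo = I.hi then constPiece I (max (e.eval I.sample) ehat)
      else
        let v₁ := rightLim e.eval I.lo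
        let v₂ := leftLim e.eval I.hi
        if max v₁ v₂ ≤ ehat then constPiece I ehat
        else if ehat ≤ min v₁ v₂ then [⟨I, e⟩]
        else
          let b : ℝ := sInf {y : ℝ | y ∈ I.toSet ∧ e.eval y = ehat}
          let I₁ : Ivl := ⟨I.lo, b, I.loClosed, false⟩
          let I₂ : Ivl := ⟨b, I.hi, true, I.hiClosed⟩
          if v₁ < v₂ then constPiece I₁ ehat ++ [⟨I₂, e⟩]
          else ⟨I₁, e⟩ :: constPiece I₂ ehat
  else []

/-- The symbolic supremum `y ↦ sup_{x in the strip over y} q x`. -/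
def maxOut (q : PW) (s : Strip) : PW :=
  PW.simplify ((cells (breakPoints q s)).flatMap (maxOutOn q s))

/-! ### Pointwise maximum -/

/-- The pointwise maximum of finitely many piecewise functions: between consecutive endpoints of
pieces, the interval is split where two of the functions agree. -/
def maxPieces (fs : List PW) : PW :=
  (cells (fs.flatten.flatMap fun P => finitePart P.dom.lo ++ finitePart P.dom.hi)).flatMap fun K =>
    let act := fs.filterMap fun f => f.expoAt K.sample
    let cuts := (act.flatMap fun e => act.flatMap fun e' => (e.agree e').toList).filter
      fun y => y ∈ K.toSet
    (cells cuts).filterMap fun J =>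
      let L := K.inter J
      if L.toSet.Nonempty then
        (act.foldr (fun e o => Expo.dominating L.sample (some e) o) none).map fun e => ⟨L, e⟩
      else none

/-! ### The messages -/

namespace Problem

variable {n : ℕ} (P : Problem n)

/-- The factor `f_i = ⟦x_i ⊨ Δ_i⟧ * p_i(x_i)` as a piecewise function. -/
def unaryFactor (i : Fin n) : PW :=
  PW.simplify ((cells ((P.litsOn {i}).flatMap fun l =>
      if l.atom.coeff i = 0 then [] else [l.atom.rhs / l.atom.coeff i])).filterMap fun K =>
    (P.activePiece {i} (Function.update 0 i K.sample)).map fun w => ⟨K, .poly (w.expo i)⟩)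

/-- The lines `x_i = a * x_j + b` of `Δ_ij'`, and the smallest and the largest end of the message
`m(x_i)`. -/
def boundLines (i j : Fin n) (m : PW) : List Bound :=
  ((P.litsOn {i, j}).flatMap fun l =>
    if l.atom.coeff i = 0 then []
    else [.affine (-(l.atom.coeff j / l.atom.coeff i)) (l.atom.rhs / l.atom.coeff i)]) ++
  ((finitePart ((m.map fun Q => Q.dom.lo).foldr min ⊤)).map fun b => .affine 0 b) ++
  ((finitePart ((m.map fun Q => Q.dom.hi).foldr max ⊥)).map fun b => .affine 0 b)

/-- The critical points of `x_j`: literals on `x_j` only, and crossings of two lines. -/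
def criticalPoints (i j : Fin n) (m : PW) : List ℝ :=
  ((P.litsOn {i, j}).flatMap fun l =>
    if l.atom.coeff i = 0 ∧ l.atom.coeff j ≠ 0 then [l.atom.rhs / l.atom.coeff j] else []) ++
  ((P.boundLines i j m).flatMap fun l => (P.boundLines i j m).flatMap fun l' => l.crossing l')

/-- For bounds `u₁ < u₂ < …` above `l`: the strips `l < x < u₁`, `x = u₁`, `u₁ < x < u₂`, … -/
def stripsFrom : Bound → List Bound → List Strip
  | l, [] => [⟨l, .posInf, true⟩]
  | l, u :: t => ⟨l, u, true⟩ :: ⟨u, u, false⟩ :: stripsFrom u t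

/-- The strips into which a list of bounds divides the line over `y`. -/
def stripsAt (ls : List Bound) (y : ℝ) : List Strip :=
  stripsFrom .negInf
    (((ls.map fun l => l.eval y).toFinset.sort (· ≤ ·)).filterMap fun v =>
      ls.find? fun l => l.eval y = v)

/-- The message from the factor `f_ij` to `X_j`, namely
`x_j ↦ max_{x_i} f_ij(x_i, x_j) * m(x_i)`, where `m` is the message from `X_i` to `f_ij`. -/
def computeMsg (i j : Fin n) (m : PW) : PW :=
  (cells (P.criticalPoints i j m)).flatMap fun I =>
    let y := I.sample
    maxPieces ((stripsAt (P.boundLines i j m) y).filterMap fun s =>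
      let x : ℝ := Classical.epsilon fun x => x ∈ s.fiber y
      (P.activePiece {i, j} (Function.update (Function.update 0 i x) j y)).map fun w =>
        PW.restrict I (PW.mulExp (w.expo j) (maxOut (PW.mulExp (w.expo i) m) s)))

/-- A choice of one root in every tree of the global graph. -/
structure Rooting where
  root : P.graph.ConnectedComponent → Fin n
  root_mem : ∀ C, root C ∈ C.supp

variable {P}

/-- The distance of `i` from the root of its tree. -/
def Rooting.depth (r : P.Rooting) (i : Fin n) : ℕ :=
  P.graph.dist (r.root (P.graph.connectedComponentMk i)) i

/-- `i` is a child of `j`. -/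
def Rooting.IsChild (r : P.Rooting) (i j : Fin n) : Prop :=
  P.graph.Adj i j ∧ r.depth i = r.depth j + 1

/-- The children of `j`. -/
def Rooting.children (r : P.Rooting) (j : Fin n) : List (Fin n) :=
  (List.finRange n).filter fun i => r.IsChild i j

/-- The message sent by the variable `X_j`: the product of `f_j` and of the messages from the
factors `f_ij` to `X_j`, over the children `i` of `j`.  For a root this is the final message of its
tree. -/
def Rooting.varMsg (r : P.Rooting) (j : Fin n) : PW :=
  ((r.children j).attach.map fun i => P.computeMsg i.1 j (r.varMsg i.1)).foldl PW.mul
    (P.unaryFactor j)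
  termination_by Finset.univ.sup r.depth - r.depth j
  decreasing_by
    have hi := i.2
    simp only [Rooting.children, List.mem_filter, List.mem_finRange, true_and,
      decide_eq_true_eq] at hi
    have h1 := hi.2
    have h2 : r.depth i.1 ≤ Finset.univ.sup r.depth := Finset.le_sup (Finset.mem_univ _)
    omega

/-- The message from the factor `f_ij` to `X_j`, for a child `i` of `j`. -/
def Rooting.factorMsg (r : P.Rooting) (i j : Fin n) : PW :=
  P.computeMsg i j (r.varMsg i)

/-- The total number of pieces of all messages: from the univariate factors to the variables, from
the bivariate factors to the parent variables, and from the variables (including the final messages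
at the roots). -/
def Rooting.totalPieces (r : P.Rooting) : ℕ :=
  ∑ j, ((P.unaryFactor j).length + (r.varMsg j).length +
    ((r.children j).map fun i => (r.factorMsg i j).length).sum)

end Problem

/-- The diameter of a forest: the largest distance between two vertices of the same tree. -/
def forestDiam {n : ℕ} (G : SimpleGraph (Fin n)) : ℕ :=
  Finset.univ.sup fun u => Finset.univ.sup fun v => G.dist u v

/-- For a connected graph this is the usual diameter. -/
theorem forestDiam_eq_diam {n : ℕ} (G : SimpleGraph (Fin n)) (hG : G.Connected) :
    forestDiam G = G.diam := by
  have := hG.nonempty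
  apply le_antisymm
  · refine Finset.sup_le fun u _ => Finset.sup_le fun v _ => ?_
    exact SimpleGraph.dist_le_diam (SimpleGraph.connected_iff_ediam_ne_top.mp hG)
  · obtain ⟨u, v, h⟩ := G.exists_dist_eq_diam
    rw [← h]
    exact (Finset.le_sup (f := fun v => G.dist u v) (Finset.mem_univ v)).trans
      (Finset.le_sup (f := fun u => Finset.univ.sup fun v => G.dist u v) (Finset.mem_univ u))

end MpMap

end

noncomputable section

namespace MpMap

open scoped Classical

/-! ### Counting in lists -/

/-! The proof never looks at the values of the messages; it follows only list lengths and polynomial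
degrees through the algorithm.

Degrees do not grow. A product adds exponents, bounds are affine so substitution keeps the degree,
new constants have degree 0, and maximum, restriction and merging only select existing exponents.
Hence every message satisfies `PW.DegLE q`, and two of its exponents yield at most `q` crossings.

Lengths grow linearly. A product costs only the sum of the lengths, by the sweep in `PW.overlay`.
For a bivariate factor there are O(c^2) cells of the parent variable and O(c) strips over each. A
strip supremum has O(q(|m|+1)) pieces. In the maximum, the endpoints of all these pieces give O(c q
(|m|+1)) intervals, and each interval is cut at O(c^2 q) crossings, because only one exponent per
strip is active there. The product of these counts is `length_computeMsg_le`: at most K c^5 q^2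
(|m|+1), with K absolute.

With b_j = `inputPieces`, this reads b_j ≤ 4c + K c^5 q^2 · (sum of b_i over the children i of j).
In a forest each vertex has at most one parent (`isChild_unique`), so level sums obey a scalar
recurrence, and `sum_forest_le` bounds the total by (d+1) n (K c^5 q^2)^d · 4c. The factor K^d is
not an absolute constant, but d ≤ n, so `exists_pow_le_mul_pow` absorbs it into C n^d. -/

theorem length_flatMap_le {α β : Type*} (l : List α) (f : α → List β) (k : ℕ)
    (h : ∀ a ∈ l, (f a).length ≤ k) : (l.flatMap f).length ≤ l.length * k := by
  rw [List.length_flatMap]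
  have := List.sum_le_card_nsmul (l.map fun a => (f a).length) k (by simpa using h)
  simpa using this

theorem length_cellsFrom (a : EReal) (B : List ℝ) :
    (cellsFrom a B).length = 2 * B.length + 1 := by
  induction B generalizing a with
  | nil => rfl
  | cons b t ih => simp only [cellsFrom, List.length_cons, ih]; ring

theorem length_cells_le (B : List ℝ) : (cells B).length ≤ 2 * B.length + 1 := by
  rw [cells, length_cellsFrom, Finset.length_sort]
  have := B.toFinset_card_le
  omega

theorem length_finitePart_le (e : EReal) : (finitePart e).length ≤ 1 := by
  unfold finitePart; split_ifs <;> simp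

theorem length_constPiece_le (I : Ivl) (v : EReal) : (constPiece I v).length ≤ 1 := by
  unfold constPiece; split <;> simp

theorem Bound.length_preimage_le (l : Bound) (v : EReal) : (l.preimage v).length ≤ 1 := by
  unfold Bound.preimage
  split
  · split_ifs
    · simp
    · simpa using length_finitePart_le v
  · simp

theorem Bound.length_crossing_le (l l' : Bound) : (l.crossing l').length ≤ 1 := by
  unfold Bound.crossing
  split
  · split_ifs <;> simp
  · simp

theorem Problem.length_stripsFrom (l : Bound) (us : List Bound) :
    (Problem.stripsFrom l us).length = 2 * us.length + 1 := by
  induction us generalizing l with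
  | nil => rfl
  | cons b t ih => simp only [Problem.stripsFrom, List.length_cons, ih]; ring

theorem Problem.length_stripsAt_le (ls : List Bound) (y : ℝ) :
    (Problem.stripsAt ls y).length ≤ 2 * ls.length + 1 := by
  rw [Problem.stripsAt, Problem.length_stripsFrom]
  have h1 := List.length_filterMap_le (fun v => ls.find? fun l => l.eval y = v)
    ((ls.map fun l => l.eval y).toFinset.sort (· ≤ ·))
  rw [Finset.length_sort] at h1
  have h2 := (ls.map fun l => l.eval y).toFinset_card_le
  rw [List.length_map] at h2
  omega

/-- Each step of the sweep discards one piece and emits at most one overlap. The bound is a sum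
rather than a product, which keeps the recurrence over the tree linear. -/
theorem PW.length_overlay_le (f g : PW) : (PW.overlay f g).length ≤ f.length + g.length := by
  induction f, g using PW.overlay.induct with
  | case1 g => simp [PW.overlay]
  | case2 P f => simp [PW.overlay]
  | case3 P f Q g _ ih1 ih2 | case4 P f Q g _ ih1 ih2 =>
    rw [PW.overlay]
    simp only [List.length_cons] at *
    split_ifs <;> (try simp only [List.length_cons]) <;> omega

theorem PW.length_mul_le (f g : PW) : (f.mul g).length ≤ f.length + g.length := by
  simpa [PW.mul] using PW.length_overlay_le f g

theorem PW.length_foldl_mul_le (fs : List PW) (f : PW) :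
    (fs.foldl PW.mul f).length ≤ f.length + (fs.map List.length).sum := by
  induction fs generalizing f with
  | nil => simp
  | cons g fs ih =>
    have := ih (f.mul g)
    have := PW.length_mul_le f g
    simp only [List.foldl_cons, List.map_cons, List.sum_cons]
    omega

theorem PW.length_simplifyFrom_le (P : Piece) (f : PW) :
    (PW.simplifyFrom P f).length ≤ f.length + 1 := by
  induction f generalizing P with
  | nil => simp [PW.simplifyFrom]
  | cons Q f ih =>
    rw [PW.simplifyFrom]
    split
    · exact (ih _).trans (by simp)
    · simpa using ih Q

theorem PW.length_simplify_le (f : PW) : f.simplify.length ≤ f.length := by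
  cases f with
  | nil => simp [PW.simplify]
  | cons P f => exact PW.length_simplifyFrom_le P f

theorem PW.length_comp_le (f : PW) (l : Bound) : (f.comp l).length ≤ f.length + 1 := by
  unfold PW.comp
  split
  · split_ifs
    · split <;> simp
    · simp
    · simp
  · simp

theorem length_lowerComp_le (q : PW) (s : Strip) : (lowerComp q s).length ≤ q.length + 1 := by
  refine (PW.length_comp_le _ _).trans ?_
  split_ifs
  · simpa [PW.rightGerm] using List.length_filter_le _ q
  · rfl

theorem length_upperComp_le (q : PW) (s : Strip) : (upperComp q s).length ≤ q.length + 1 := by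
  refine (PW.length_comp_le _ _).trans ?_
  split_ifs
  · simpa [PW.leftGerm] using List.length_filter_le _ q
  · rfl

/-! ### Degrees -/

/-- The exponent is `top` or a polynomial of degree at most `q`. -/
def Expo.DegLE (q : ℕ) : Expo → Prop
  | .top => True
  | .poly p => p.natDegree ≤ q

/-- All exponents have degree at most `q`. -/
def PW.DegLE (q : ℕ) (f : PW) : Prop := ∀ P ∈ f, P.expo.DegLE q

variable {q : ℕ}

theorem Expo.DegLE.sum {e e' : Expo} (h : e.DegLE q) (h' : e'.DegLE q) :
    (e.sum e').DegLE q := by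
  cases e <;> cases e' <;> simp only [Expo.sum, Expo.DegLE] at *
  exact (Polynomial.natDegree_add_le _ _).trans (max_le h h')

theorem Expo.DegLE.compAffine {e : Expo} (h : e.DegLE q) (a b : ℝ) :
    (e.compAffine a b).DegLE q := by
  cases e with
  | top => trivial
  | poly p =>
    refine Polynomial.natDegree_comp_le.trans ((Nat.mul_le_mul h ?_).trans_eq (mul_one q))
    exact Polynomial.natDegree_linear_le

/-- A nonzero difference has at most `q` roots; for equal polynomials the root multiset of 0 is
empty, so identical exponents cause no cut. -/
theorem Expo.DegLE.card_agree_le {e e' : Expo} (h : e.DegLE q) (h' : e'.DegLE q) :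
    (e.agree e').card ≤ q := by
  cases e <;> cases e' <;> simp only [Expo.agree, Finset.card_empty, zero_le]
  refine (Multiset.toFinset_card_le _).trans ((Polynomial.card_roots' _).trans ?_)
  exact (Polynomial.natDegree_sub_le _ _).trans (max_le h h')

theorem Expo.DegLE.card_critical_le {e : Expo} (h : e.DegLE q) : e.critical.card ≤ q := by
  cases e with
  | top => simp [Expo.critical]
  | poly p =>
    refine (Multiset.toFinset_card_le _).trans ((Polynomial.card_roots' _).trans ?_)
    exact ((Polynomial.natDegree_derivative_le p).trans (Nat.sub_le _ _)).trans h

theorem Expo.DegLE.of_ofValue {v : EReal} {e : Expo} (h : Expo.ofValue v = some e) :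
    e.DegLE q := by
  unfold Expo.ofValue at h
  split_ifs at h <;> cases h <;> simp [Expo.DegLE]

/-- A maximum selects an exponent and creates none, so degree bounds pass through it. -/
theorem Expo.eq_of_dominating {y : ℝ} {a b : Option Expo} {e : Expo}
    (h : Expo.dominating y a b = some e) : a = some e ∨ b = some e := by
  cases a <;> cases b <;> simp only [Expo.dominating] at h
  · exact .inr h
  · exact .inr h
  · exact .inl h
  · split_ifs at h
    · exact .inl h
    · exact .inr h

theorem PW.DegLE.of_expoAt {f : PW} (hf : f.DegLE q) {x : ℝ} {e : Expo}
    (h : f.expoAt x = some e) : e.DegLE q := by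
  rw [PW.expoAt, Option.map_eq_some_iff] at h
  obtain ⟨P, hP, rfl⟩ := h
  exact hf P (List.mem_of_find?_eq_some hP)

theorem PW.mem_overlay {f g : PW} {t : Ivl × Expo × Expo} (ht : t ∈ PW.overlay f g) :
    (∃ P ∈ f, t.2.1 = P.expo) ∧ ∃ Q ∈ g, t.2.2 = Q.expo := by
  induction f, g using PW.overlay.induct with
  | case1 g => simp [PW.overlay] at ht
  | case2 P f => simp [PW.overlay] at ht
  | case3 P f Q g _ ih1 ih2 | case4 P f Q g _ ih1 ih2 =>
    rw [PW.overlay] at ht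
    have key : t = (P.dom.inter Q.dom, P.expo, Q.expo) ∨ t ∈ PW.overlay f (Q :: g) ∨
        t ∈ PW.overlay (P :: f) g := by
      split_ifs at ht <;> (try simp only [List.mem_cons] at ht) <;> tauto
    rcases key with rfl | h | h
    · exact ⟨⟨P, by simp, rfl⟩, ⟨Q, by simp, rfl⟩⟩
    · obtain ⟨⟨A, hA, hA'⟩, hB⟩ := ih1 h
      exact ⟨⟨A, by simp [hA], hA'⟩, hB⟩
    · obtain ⟨hA, ⟨B, hB, hB'⟩⟩ := ih2 h
      exact ⟨hA, ⟨B, by simp [hB], hB'⟩⟩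

theorem PW.DegLE.mul {f g : PW} (hf : f.DegLE q) (hg : g.DegLE q) : (f.mul g).DegLE q := by
  intro R hR
  obtain ⟨t, ht, rfl⟩ := List.mem_map.mp hR
  obtain ⟨⟨P, hP, hP'⟩, Q, hQ, hQ'⟩ := PW.mem_overlay ht
  exact Expo.DegLE.sum (hP' ▸ hf P hP) (hQ' ▸ hg Q hQ)

theorem PW.DegLE.foldl_mul {fs : List PW} (hfs : ∀ g ∈ fs, g.DegLE q) {f : PW}
    (hf : f.DegLE q) : (fs.foldl PW.mul f).DegLE q := by
  induction fs generalizing f with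
  | nil => exact hf
  | cons g fs ih =>
    exact ih (fun h hh => hfs h (by simp [hh])) (hf.mul (hfs g (by simp)))

theorem PW.DegLE.mulExp {f : PW} (hf : f.DegLE q) {p : Polynomial ℝ} (hp : p.natDegree ≤ q) :
    (PW.mulExp p f).DegLE q := by
  intro R hR
  obtain ⟨P, hP, rfl⟩ := List.mem_map.mp hR
  exact (hf P hP).sum (e' := .poly p) hp

theorem PW.DegLE.restrict {f : PW} (hf : f.DegLE q) (I : Ivl) : (PW.restrict I f).DegLE q := by
  intro R hR
  obtain ⟨P, hP, h⟩ := List.mem_filterMap.mp hR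
  split_ifs at h
  cases h
  exact hf P hP

theorem PW.DegLE.rightGerm {f : PW} (hf : f.DegLE q) : f.rightGerm.DegLE q := by
  intro R hR
  obtain ⟨P, hP, rfl⟩ := List.mem_map.mp hR
  exact hf P (List.mem_of_mem_filter hP)

theorem PW.DegLE.leftGerm {f : PW} (hf : f.DegLE q) : f.leftGerm.DegLE q := by
  intro R hR
  obtain ⟨P, hP, rfl⟩ := List.mem_map.mp hR
  exact hf P (List.mem_of_mem_filter hP)

theorem PW.DegLE.comp {f : PW} (hf : f.DegLE q) (l : Bound) : (f.comp l).DegLE q := by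
  unfold PW.comp
  split
  · split_ifs
    · split
      · simp [PW.DegLE]
      · rename_i e he
        intro R hR
        rw [List.mem_singleton] at hR
        subst hR
        exact .of_ofValue he
    · intro R hR
      obtain ⟨P, hP, rfl⟩ := List.mem_map.mp hR
      exact (hf P hP).compAffine _ _
    · intro R hR
      obtain ⟨P, hP, rfl⟩ := List.mem_map.mp hR
      exact (hf P (List.mem_reverse.mp hP)).compAffine _ _
  · simp [PW.DegLE]

theorem PW.DegLE.lowerComp {f : PW} (hf : f.DegLE q) (s : Strip) : (lowerComp f s).DegLE q := by
  unfold MpMap.lowerComp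
  split_ifs
  · exact hf.rightGerm.comp _
  · exact hf.comp _

theorem PW.DegLE.upperComp {f : PW} (hf : f.DegLE q) (s : Strip) : (upperComp f s).DegLE q := by
  unfold MpMap.upperComp
  split_ifs
  · exact hf.leftGerm.comp _
  · exact hf.comp _

theorem PW.expo_of_join {P Q R : Piece} (h : PW.join P Q = some R) :
    R.expo = P.expo ∨ R.expo = Q.expo := by
  unfold PW.join at h
  simp only at h
  split_ifs at h <;> cases h <;> simp

theorem PW.DegLE.simplifyFrom {P : Piece} {f : PW} (hP : P.expo.DegLE q) (hf : f.DegLE q) :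
    (PW.simplifyFrom P f).DegLE q := by
  induction f generalizing P with
  | nil => simpa [PW.simplifyFrom, PW.DegLE] using hP
  | cons Q f ih =>
    have hQ : Q.expo.DegLE q := hf Q (by simp)
    have hf' : PW.DegLE q f := fun R hR => hf R (by simp [hR])
    rw [PW.simplifyFrom]
    split
    · rename_i R hR
      refine ih ?_ hf'
      rcases PW.expo_of_join hR with h | h <;> rw [h] <;> assumption
    · intro R hR
      rcases List.mem_cons.mp hR with rfl | hR
      · exact hP
      · exact ih hQ hf' R hR

theorem PW.DegLE.simplify {f : PW} (hf : f.DegLE q) : f.simplify.DegLE q := by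
  cases f with
  | nil => exact hf
  | cons P f => exact .simplifyFrom (hf P (by simp)) fun R hR => hf R (by simp [hR])

theorem degLE_constPiece (I : Ivl) (v : EReal) : PW.DegLE q (constPiece I v) := by
  unfold constPiece
  split
  · simp [PW.DegLE]
  · rename_i e he
    intro R hR
    rw [List.mem_singleton] at hR
    subst hR
    exact .of_ofValue he

theorem PW.DegLE.append {f g : PW} (hf : f.DegLE q) (hg : g.DegLE q) : PW.DegLE q (f ++ g) := by
  intro P hP
  rcases List.mem_append.mp hP with h | h
  · exact hf P h
  · exact hg P h

theorem PW.DegLE.singleton {e : Expo} (he : e.DegLE q) (I : Ivl) : PW.DegLE q [⟨I, e⟩] := by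
  intro P hP
  rw [List.mem_singleton] at hP
  exact hP ▸ he

/-! ### The symbolic supremum -/

/-- On one interval the definition switches at most once between the constant and the chosen
composition. -/
theorem length_maxOutOn_le (f : PW) (s : Strip) (I : Ivl) : (maxOutOn f s I).length ≤ 2 := by
  have h : ∀ I v, (constPiece I v).length ≤ 1 := length_constPiece_le
  unfold maxOutOn
  split
  · dsimp only
    split
    · exact (h _ _).trans (by norm_num)
    · split_ifs
      · exact (h _ _).trans (by norm_num)
      · exact (h _ _).trans (by norm_num)
      · simp
      · simpa using h _ _
      · simpa using h _ _
  · simp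

theorem PW.DegLE.maxOutOn {f : PW} (hf : f.DegLE q) (s : Strip) (I : Ivl) :
    (maxOutOn f s I).DegLE q := by
  unfold MpMap.maxOutOn
  split
  · dsimp only
    split
    · exact degLE_constPiece _ _
    · rename_i e he
      have hd : e.DegLE q := by
        rcases Expo.eq_of_dominating he with h | h
        · exact (hf.lowerComp s).of_expoAt h
        · exact (hf.upperComp s).of_expoAt h
      split_ifs
      · exact degLE_constPiece _ _
      · exact degLE_constPiece _ _
      · exact .singleton hd _
      · exact (degLE_constPiece _ _).append (.singleton hd _)
      · exact (PW.DegLE.singleton hd _).append (degLE_constPiece _ _)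
  · simp [PW.DegLE]

theorem PW.DegLE.maxOut {f : PW} (hf : f.DegLE q) (s : Strip) : (maxOut f s).DegLE q := by
  refine PW.DegLE.simplify fun P hP => ?_
  obtain ⟨I, -, hI⟩ := List.mem_flatMap.mp hP
  exact hf.maxOutOn s I P hI

theorem PW.DegLE.length_breaksAndExtrema_le {f : PW} (hf : f.DegLE q) :
    f.breaksAndExtrema.length ≤ f.length * (q + 2) := by
  refine length_flatMap_le _ _ _ fun P hP => ?_
  have h1 := (hf P hP).card_critical_le
  have h2 := Finset.card_filter_le P.expo.critical fun x => x ∈ P.dom.toSet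
  have h3 : (P.expo.critical.filter fun x => x ∈ P.dom.toSet).card ≤ q := h2.trans h1
  simpa using h3

theorem PW.DegLE.length_breakPoints_le {f : PW} (hf : f.DegLE q) (hq : 1 ≤ q) (s : Strip) :
    (breakPoints f s).length ≤ 9 * ((f.length + 1) * q) := by
  have h1 : (f.breaksAndExtrema.flatMap fun v => s.l.preimage v ++ s.u.preimage v).length ≤
      f.length * (q + 2) * 2 := by
    refine (length_flatMap_le _ _ 2 fun v _ => ?_).trans
      (Nat.mul_le_mul_right _ hf.length_breaksAndExtrema_le)
    have := s.l.length_preimage_le v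
    have := s.u.length_preimage_le v
    rw [List.length_append]; omega
  have h2 : ((PW.overlay (MpMap.upperComp f s) (MpMap.lowerComp f s)).flatMap fun t =>
      ((t.2.1.agree t.2.2).filter fun y => y ∈ t.1.toSet).toList).length ≤
      ((f.length + 1) + (f.length + 1)) * q := by
    refine (length_flatMap_le _ _ q fun t ht => ?_).trans (Nat.mul_le_mul_right _
      ((PW.length_overlay_le _ _).trans
        (add_le_add (length_upperComp_le f s) (length_lowerComp_le f s))))
    obtain ⟨⟨A, hA, hA'⟩, B, hB, hB'⟩ := PW.mem_overlay ht
    rw [Finset.length_toList]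
    refine (Finset.card_filter_le _ _).trans ?_
    rw [hA', hB']
    exact (hf.upperComp s A hA).card_agree_le (hf.lowerComp s B hB)
  have h3 := s.l.length_crossing_le s.u
  rw [breakPoints, List.length_append]
  refine (Nat.add_le_add_right (List.length_filter_le _ _) _).trans ?_
  rw [List.length_append]
  -- With L the length of `f`, the count is 2L(q+2) + 2(L+1)q + 1; the terms without a factor `q`
  -- are absorbed using 1 ≤ q.
  nlinarith [Nat.mul_le_mul_left f.length hq]

theorem PW.DegLE.length_maxOut_le {f : PW} (hf : f.DegLE q) (hq : 1 ≤ q) (s : Strip) :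
    (MpMap.maxOut f s).length ≤ 38 * ((f.length + 1) * q) := by
  have h := hf.length_breakPoints_le hq s
  have h1 := length_cells_le (breakPoints f s)
  have h2 := length_flatMap_le (cells (breakPoints f s)) (MpMap.maxOutOn f s) 2
    fun I _ => length_maxOutOn_le f s I
  have h3 := PW.length_simplify_le ((cells (breakPoints f s)).flatMap (MpMap.maxOutOn f s))
  -- For X = (L+1)q, with L the length of `f`, two pieces per cell give 2(2·9X + 1) ≤ 38X, since X ≥
  -- 1.
  have h4 : 1 ≤ (f.length + 1) * q := Nat.mul_pos (Nat.succ_pos _) hq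
  rw [MpMap.maxOut]
  omega

/-! ### The pointwise maximum -/

theorem Expo.mem_of_foldr_dominating {y : ℝ} {act : List Expo} {e : Expo}
    (h : act.foldr (fun e o => Expo.dominating y (some e) o) none = some e) : e ∈ act := by
  induction act with
  | nil => simp at h
  | cons a act ih =>
    rw [List.foldr_cons] at h
    rcases Expo.eq_of_dominating h with h | h
    · cases h; simp
    · exact List.mem_cons_of_mem _ (ih h)

theorem degLE_of_mem_filterMap_expoAt {fs : List PW} (hfs : ∀ f ∈ fs, PW.DegLE q f) {x : ℝ}
    {e : Expo} (he : e ∈ fs.filterMap fun f => f.expoAt x) : e.DegLE q := by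
  obtain ⟨f, hf, h⟩ := List.mem_filterMap.mp he
  exact (hfs f hf).of_expoAt h

theorem degLE_maxPieces {fs : List PW} (hfs : ∀ f ∈ fs, PW.DegLE q f) :
    (maxPieces fs).DegLE q := by
  intro R hR
  obtain ⟨K, -, hK⟩ := List.mem_flatMap.mp hR
  obtain ⟨J, -, hJ⟩ := List.mem_filterMap.mp hK
  dsimp only at hJ
  split_ifs at hJ
  obtain ⟨e, he, rfl⟩ := Option.map_eq_some_iff.mp hJ
  exact degLE_of_mem_filterMap_expoAt hfs (Expo.mem_of_foldr_dominating he)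

/-- Two endpoints per piece account for the first factor. In one cell each function contributes at
most one active exponent, so the second factor counts pairs of functions, not pairs of pieces: piece
numbers enter only linearly. -/
theorem length_maxPieces_le {fs : List PW} (hfs : ∀ f ∈ fs, PW.DegLE q f) :
    (maxPieces fs).length ≤
      (4 * fs.flatten.length + 1) * (2 * (fs.length * (fs.length * q)) + 1) := by
  refine (length_flatMap_le _ _ (2 * (fs.length * (fs.length * q)) + 1) fun K _ => ?_).trans
    (Nat.mul_le_mul_right _ ?_)
  · have hact : (fs.filterMap fun f => f.expoAt K.sample).length ≤ fs.length :=
      List.length_filterMap_le _ _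
    refine (List.length_filterMap_le _ _).trans ((length_cells_le _).trans ?_)
    refine Nat.add_le_add_right (Nat.mul_le_mul_left 2 ((List.length_filter_le _ _).trans ?_)) 1
    refine (length_flatMap_le _ _ (fs.length * q) fun e he => ?_).trans
      (Nat.mul_le_mul_right _ hact)
    refine (length_flatMap_le _ _ q fun e' he' => ?_).trans (Nat.mul_le_mul_right _ hact)
    rw [Finset.length_toList]
    exact (degLE_of_mem_filterMap_expoAt hfs he).card_agree_le
      (degLE_of_mem_filterMap_expoAt hfs he')
  · refine (length_cells_le _).trans ?_
    have := length_flatMap_le fs.flatten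
      (fun P => finitePart P.dom.lo ++ finitePart P.dom.hi) 2 fun P _ => by
        have := length_finitePart_le P.dom.lo
        have := length_finitePart_le P.dom.hi
        rw [List.length_append]; omega
    omega

/-! ### Messages -/

namespace Problem

variable {n : ℕ} {P : Problem n} {c : ℕ}

theorem mem_weightOn_of_activePiece {S : Finset (Fin n)} {x : Fin n → ℝ} {w : WeightPiece n}
    (h : P.activePiece S x = some w) : w ∈ P.weightOn S := by
  unfold activePiece at h
  split_ifs at h
  exact List.mem_of_find?_eq_some h

theorem DegLE.natDegree_expo_le (hP : P.DegLE q) {S : Finset (Fin n)} {w : WeightPiece n}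
    (hw : w ∈ P.weightOn S) {s : Fin n} (hs : s ∈ S) : (w.expo s).natDegree ≤ q := by
  unfold weightOn at hw
  cases h : P.p S with
  | none =>
    rw [h, Option.getD_none, List.mem_singleton] at hw
    subst hw
    simp
  | some W =>
    rw [h, Option.getD_some] at hw
    exact hP S W h w hw s hs

theorem degLE_unaryFactor (hP : P.DegLE q) (i : Fin n) : (P.unaryFactor i).DegLE q := by
  refine PW.DegLE.simplify fun R hR => ?_
  obtain ⟨K, -, hK⟩ := List.mem_filterMap.mp hR
  obtain ⟨w, hw, rfl⟩ := Option.map_eq_some_iff.mp hK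
  exact hP.natDegree_expo_le (mem_weightOn_of_activePiece hw) (Finset.mem_singleton_self i)

theorem length_unaryFactor_le {i : Fin n} (hi : P.size {i} ≤ c) :
    (P.unaryFactor i).length ≤ 2 * c + 1 := by
  refine (PW.length_simplify_le _).trans ((List.length_filterMap_le _ _).trans
    ((length_cells_le _).trans ?_))
  have h := length_flatMap_le (P.litsOn {i})
    (fun l => if l.atom.coeff i = 0 then [] else [l.atom.rhs / l.atom.coeff i]) 1
    fun l _ => by split_ifs <;> simp
  have : (P.litsOn {i}).length ≤ c := hi
  omega

theorem length_boundLines_le {i j : Fin n} (hij : P.size {i, j} ≤ c) (m : PW) :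
    (P.boundLines i j m).length ≤ c + 2 := by
  have h := length_flatMap_le (P.litsOn {i, j})
    (fun l => if l.atom.coeff i = 0 then []
      else [Bound.affine (-(l.atom.coeff j / l.atom.coeff i)) (l.atom.rhs / l.atom.coeff i)]) 1
    fun l _ => by split_ifs <;> simp
  have h' : (P.litsOn {i, j}).length ≤ c := hij
  have h1 := length_finitePart_le ((m.map fun Q => Q.dom.lo).foldr min ⊤)
  have h2 := length_finitePart_le ((m.map fun Q => Q.dom.hi).foldr max ⊥)
  rw [boundLines, List.length_append, List.length_append, List.length_map, List.length_map]
  omega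

theorem length_criticalPoints_le {i j : Fin n} (hij : P.size {i, j} ≤ c) (m : PW) :
    (P.criticalPoints i j m).length ≤ c + (c + 2) * (c + 2) := by
  have h := length_flatMap_le (P.litsOn {i, j})
    (fun l => if l.atom.coeff i = 0 ∧ l.atom.coeff j ≠ 0 then [l.atom.rhs / l.atom.coeff j]
      else []) 1 fun l _ => by split_ifs <;> simp
  have h' : (P.litsOn {i, j}).length ≤ c := hij
  have hb := length_boundLines_le hij m
  rw [criticalPoints, List.length_append]
  refine add_le_add (by omega) ?_
  refine (length_flatMap_le _ _ (c + 2) fun l _ => ?_).trans (Nat.mul_le_mul_right _ hb)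
  refine (length_flatMap_le _ _ 1 fun l' _ => l.length_crossing_le l').trans ?_
  omega

/-- The contribution of one strip to a message over the interval `I`. -/
def stripMsg (P : Problem n) (i j : Fin n) (m : PW) (I : Ivl) (s : Strip) : Option PW :=
  (P.activePiece {i, j} (Function.update (Function.update 0 i
    (Classical.epsilon fun x => x ∈ s.fiber I.sample)) j I.sample)).map fun w =>
      PW.restrict I (PW.mulExp (w.expo j) (maxOut (PW.mulExp (w.expo i) m) s))

theorem computeMsg_eq (P : Problem n) (i j : Fin n) (m : PW) :
    P.computeMsg i j m = (cells (P.criticalPoints i j m)).flatMap fun I =>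
      maxPieces ((stripsAt (P.boundLines i j m) I.sample).filterMap (P.stripMsg i j m I)) :=
  rfl

theorem degLE_stripMsg (hP : P.DegLE q) {m : PW} (hm : m.DegLE q) {i j : Fin n} {I : Ivl}
    {s : Strip} {f : PW} (h : P.stripMsg i j m I s = some f) : f.DegLE q := by
  obtain ⟨w, hw, rfl⟩ := Option.map_eq_some_iff.mp h
  have hw' := mem_weightOn_of_activePiece hw
  exact (((hm.mulExp (hP.natDegree_expo_le hw' (by simp))).maxOut s).mulExp
    (hP.natDegree_expo_le hw' (by simp))).restrict I

theorem length_stripMsg_le (hP : P.DegLE q) (hq : 1 ≤ q) {m : PW} (hm : m.DegLE q)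
    {i j : Fin n} {I : Ivl} {s : Strip} {f : PW} (h : P.stripMsg i j m I s = some f) :
    f.length ≤ 38 * ((m.length + 1) * q) := by
  obtain ⟨w, hw, rfl⟩ := Option.map_eq_some_iff.mp h
  have hw' := mem_weightOn_of_activePiece hw
  refine (List.length_filterMap_le _ _).trans ?_
  have := (hm.mulExp (hP.natDegree_expo_le hw' (s := i) (by simp))).length_maxOut_le hq s
  simpa [PW.mulExp] using this

theorem degLE_computeMsg (hP : P.DegLE q) {m : PW} (hm : m.DegLE q) (i j : Fin n) :
    (P.computeMsg i j m).DegLE q := by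
  intro R hR
  rw [computeMsg_eq] at hR
  obtain ⟨I, -, hI⟩ := List.mem_flatMap.mp hR
  refine degLE_maxPieces (fun f hf => ?_) R hI
  obtain ⟨s, -, hs⟩ := List.mem_filterMap.mp hf
  exact degLE_stripMsg hP hm hs

/-- Multiplies the three counts: cells of the parent variable, intervals between endpoints, and cuts
at crossings. The constant is 21 · 1065 · 99. -/
theorem length_computeMsg_le (hP : P.DegLE q) (hq : 1 ≤ q) (hc : 1 ≤ c) {m : PW}
    (hm : m.DegLE q) {i j : Fin n} (hij : P.size {i, j} ≤ c) :
    (P.computeMsg i j m).length ≤ 2214135 * (c ^ 5 * q ^ 2) * (m.length + 1) := by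
  set M := m.length + 1 with hM
  have hM1 : 1 ≤ M := Nat.succ_pos _
  rw [computeMsg_eq]
  have hcell : ∀ I : Ivl, (maxPieces ((stripsAt (P.boundLines i j m) I.sample).filterMap
      (P.stripMsg i j m I))).length ≤ (1065 * (c * M * q)) * (99 * (c ^ 2 * q)) := by
    intro I
    set fs := (stripsAt (P.boundLines i j m) I.sample).filterMap (P.stripMsg i j m I) with hfs
    -- At most c + 2 lines give 2(c+2) + 1 strips.
    have hlen : fs.length ≤ 7 * c := by
      have h1 := length_boundLines_le hij m
      have h2 := length_stripsAt_le (P.boundLines i j m) I.sample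
      have h3 := List.length_filterMap_le (P.stripMsg i j m I)
        (stripsAt (P.boundLines i j m) I.sample)
      rw [← hfs] at h3
      omega
    have hflat : fs.flatten.length ≤ fs.length * (38 * (M * q)) := by
      rw [← List.flatMap_id]
      refine length_flatMap_le _ _ _ fun f hf => ?_
      obtain ⟨s, -, hs⟩ := List.mem_filterMap.mp hf
      exact length_stripMsg_le hP hq hm hs
    refine (length_maxPieces_le (q := q) fun f hf => ?_).trans (Nat.mul_le_mul ?_ ?_)
    · obtain ⟨s, -, hs⟩ := List.mem_filterMap.mp hf
      exact degLE_stripMsg hP hm hs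
    · have h1 : 1 ≤ c * M * q := Nat.mul_pos (Nat.mul_pos hc hM1) hq
      have h2 : fs.length * (38 * (M * q)) ≤ 7 * c * (38 * (M * q)) :=
        Nat.mul_le_mul_right _ hlen
      have h3 : 7 * c * (38 * (M * q)) = 266 * (c * M * q) := by ring
      omega
    · have h1 : 1 ≤ c ^ 2 * q := Nat.mul_pos (pow_pos hc 2) hq
      have h2 : fs.length * (fs.length * q) ≤ 7 * c * (7 * c * q) :=
        Nat.mul_le_mul hlen (Nat.mul_le_mul_right _ hlen)
      have h3 : 7 * c * (7 * c * q) = 49 * (c ^ 2 * q) := by ring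
      omega
  -- Here 2(c + (c+2)^2) + 1 ≤ 2(c + 9c^2) + 1 ≤ 21c^2, by 1 ≤ c.
  have hcells : (cells (P.criticalPoints i j m)).length ≤ 21 * c ^ 2 := by
    have h1 := length_cells_le (P.criticalPoints i j m)
    have h2 := length_criticalPoints_le hij m
    nlinarith
  refine (length_flatMap_le _ _ _ fun I _ => hcell I).trans
    ((Nat.mul_le_mul_right _ hcells).trans_eq ?_)
  ring

/-! ### The recurrence along a rooted forest -/

namespace Rooting

variable (r : P.Rooting)

theorem isChild_of_mem_children {i j : Fin n} (h : i ∈ r.children j) : r.IsChild i j := by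
  simpa [children] using h

theorem varMsg_eq (j : Fin n) :
    r.varMsg j = ((r.children j).map fun i => r.factorMsg i j).foldl PW.mul
      (P.unaryFactor j) := by
  rw [varMsg]
  congr 1
  exact List.attach_map_val (l := r.children j) (f := fun i => r.factorMsg i j)

theorem depth_le_forestDiam (i : Fin n) : r.depth i ≤ forestDiam P.graph :=
  (Finset.le_sup (f := fun v => P.graph.dist _ v) (Finset.mem_univ i)).trans
    (Finset.le_sup (f := fun u => Finset.univ.sup fun v => P.graph.dist u v)
      (Finset.mem_univ _))

theorem degLE_varMsg (hP : P.DegLE q) (j : Fin n) : (r.varMsg j).DegLE q := by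
  -- Children lie one level deeper and depth is bounded by the diameter, so the difference decreases
  -- towards the leaves.
  have key : ∀ k j, forestDiam P.graph - r.depth j = k → (r.varMsg j).DegLE q := by
    intro k
    induction k using Nat.strong_induction_on with
    | _ k ih =>
      intro j hj
      rw [varMsg_eq]
      refine PW.DegLE.foldl_mul (fun g hg => ?_) (degLE_unaryFactor hP j)
      obtain ⟨i, hi, rfl⟩ := List.mem_map.mp hg
      have h1 := (r.isChild_of_mem_children hi).2
      have h2 := r.depth_le_forestDiam i
      exact degLE_computeMsg hP (ih _ (by omega) i rfl) i j
  exact key _ j rfl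

/-- The number of pieces that enter the product formed at `X_j`, plus one. -/
def inputPieces (j : Fin n) : ℕ :=
  (P.unaryFactor j).length + ((r.children j).map fun i => (r.factorMsg i j).length).sum + 1

/-- The strict inequality absorbs the `+ 1` in `length_computeMsg_le`, so no extra constant per
child appears in the recurrence. -/
theorem length_varMsg_lt (j : Fin n) : (r.varMsg j).length < r.inputPieces j := by
  have := PW.length_foldl_mul_le ((r.children j).map fun i => r.factorMsg i j)
    (P.unaryFactor j)
  rw [List.map_map] at this
  rw [varMsg_eq, inputPieces, Nat.lt_succ_iff]
  exact this

theorem totalPieces_le : r.totalPieces ≤ 2 * ∑ j, r.inputPieces j := by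
  rw [totalPieces, Finset.mul_sum]
  refine Finset.sum_le_sum fun j _ => ?_
  have := r.length_varMsg_lt j
  unfold inputPieces at *
  omega

theorem inputPieces_le (hP : P.DegLE q) (hq : 1 ≤ q) (hc : 1 ≤ c) (hs : P.SizeLE c)
    (j : Fin n) :
    r.inputPieces j ≤ 4 * c + 2214135 * (c ^ 5 * q ^ 2) *
      ∑ i with r.IsChild i j, r.inputPieces i := by
  have hu := length_unaryFactor_le (hs.1 j)
  have hsum : ((r.children j).map fun i => (r.factorMsg i j).length).sum =
      ∑ i with r.IsChild i j, (r.factorMsg i j).length := by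
    have hnodup : (r.children j).Nodup := (List.nodup_finRange n).filter _
    rw [← List.sum_toFinset _ hnodup]
    refine Finset.sum_congr ?_ fun _ _ => rfl
    ext i
    simp [children]
  have hf : ∑ i with r.IsChild i j, (r.factorMsg i j).length ≤
      2214135 * (c ^ 5 * q ^ 2) * ∑ i with r.IsChild i j, r.inputPieces i := by
    rw [Finset.mul_sum]
    refine Finset.sum_le_sum fun i hi => ?_
    have hadj := (Finset.mem_filter.mp hi).2.1
    exact (length_computeMsg_le hP hq hc (r.degLE_varMsg hP i) (hs.2 i j hadj)).trans
      (Nat.mul_le_mul_left _ (r.length_varMsg_lt i))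
  rw [inputPieces, hsum]
  omega

end Rooting

end Problem

/-! ### Summation over a rooted forest -/

/-- Summing the recurrence over level k bounds its sum by a source term for each vertex plus K times
the sum of level k + 1. Descending induction from the deepest level then multiplies by K once per
level. -/
theorem sum_level_le {ι : Type*} [Fintype ι] (dep b : ι → ℕ) (child : ι → ι → Prop)
    (hchild : ∀ i j, child i j → dep i = dep j + 1)
    (huniq : ∀ i j j', child i j → child i j' → j = j')
    {D K v : ℕ} (hdep : ∀ i, dep i ≤ D) (hK : 1 ≤ K)
    (hb : ∀ j, b j ≤ v + K * ∑ i with child i j, b i) (m k : ℕ) (hmk : k + m = D) :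
    ∑ j with dep j = k, b j ≤ (Finset.univ.filter fun j => k ≤ dep j).card * (K ^ m * v) := by
  have step : ∀ k, ∑ j with dep j = k, b j ≤
      (Finset.univ.filter fun j => dep j = k).card * v + K * ∑ i with dep i = k + 1, b i := by
    intro k
    calc ∑ j with dep j = k, b j
        ≤ ∑ j with dep j = k, (v + K * ∑ i with child i j, b i) :=
          Finset.sum_le_sum fun j _ => hb j
      _ = (Finset.univ.filter fun j => dep j = k).card * v +
            K * ∑ j with dep j = k, ∑ i with child i j, b i := by
          rw [Finset.sum_add_distrib, Finset.sum_const, smul_eq_mul, Finset.mul_sum]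
      _ ≤ _ := by
          refine Nat.add_le_add_left (Nat.mul_le_mul_left _ ?_) _
          -- Unique parents make the sets of children disjoint, so the double sum counts each vertex
          -- of the next level at most once.
          rw [← Finset.sum_biUnion]
          · refine Finset.sum_le_sum_of_subset fun i hi => ?_
            simp only [Finset.mem_biUnion, Finset.mem_filter, Finset.mem_univ, true_and] at hi ⊢
            obtain ⟨j, hj, hij⟩ := hi
            rw [hchild i j hij, hj]
          · intro j _ j' _ hne
            refine Finset.disjoint_left.mpr fun i hi hi' => hne ?_
            exact huniq i j j' (Finset.mem_filter.mp hi).2 (Finset.mem_filter.mp hi').2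
  induction m generalizing k with
  | zero =>
    have h0 : (Finset.univ.filter fun i => dep i = k + 1) = ∅ :=
      Finset.filter_eq_empty_iff.mpr fun i _ => by have := hdep i; omega
    have h := step k
    rw [h0, Finset.sum_empty, mul_zero, add_zero] at h
    rw [pow_zero, one_mul]
    refine h.trans (Nat.mul_le_mul_right _ (Finset.card_le_card fun j hj => ?_))
    simp only [Finset.mem_filter, Finset.mem_univ, true_and] at hj ⊢
    omega
  | succ m ih =>
    have h1 := ih (k + 1) (by omega)
    have hcard : (Finset.univ.filter fun j => k ≤ dep j).card =
        (Finset.univ.filter fun j => dep j = k).card +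
          (Finset.univ.filter fun j => k + 1 ≤ dep j).card := by
      rw [← Finset.card_union_of_disjoint]
      · congr 1
        ext j
        simp only [Finset.mem_filter, Finset.mem_union, Finset.mem_univ, true_and]
        omega
      · refine Finset.disjoint_filter.mpr fun j _ h => ?_
        omega
    -- Inflating the source term gives both levels the same factor, and their vertex counts add up.
    have h2 : v ≤ K ^ (m + 1) * v := Nat.le_mul_of_pos_left _ (pow_pos hK _)
    calc _ ≤ _ := step k
      _ ≤ (Finset.univ.filter fun j => dep j = k).card * (K ^ (m + 1) * v) +
          K * ((Finset.univ.filter fun j => k + 1 ≤ dep j).card * (K ^ m * v)) :=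
          add_le_add (Nat.mul_le_mul_left _ h2) (Nat.mul_le_mul_left _ h1)
      _ = _ := by rw [hcard]; ring

theorem sum_forest_le {ι : Type*} [Fintype ι] (dep b : ι → ℕ) (child : ι → ι → Prop)
    (hchild : ∀ i j, child i j → dep i = dep j + 1)
    (huniq : ∀ i j j', child i j → child i j' → j = j')
    {D K v : ℕ} (hdep : ∀ i, dep i ≤ D) (hK : 1 ≤ K)
    (hb : ∀ j, b j ≤ v + K * ∑ i with child i j, b i) :
    ∑ j, b j ≤ (D + 1) * (Fintype.card ι * (K ^ D * v)) := by
  have h := Finset.sum_fiberwise_of_maps_to (s := Finset.univ) (t := Finset.range (D + 1))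
    (g := dep) (fun i _ => Finset.mem_range.mpr (Nat.lt_succ_of_le (hdep i))) b
  rw [← h]
  refine (Finset.sum_le_card_nsmul _ _ (Fintype.card ι * (K ^ D * v)) fun k hk => ?_).trans_eq
    (by simp)
  have hk' := Finset.mem_range.mp hk
  refine (sum_level_le dep b child hchild huniq hdep hK hb (D - k) k (by omega)).trans
    (Nat.mul_le_mul (Finset.card_le_univ _) (Nat.mul_le_mul_right _ ?_))
  exact Nat.pow_le_pow_right hK (Nat.sub_le _ _)

/-! ### Distances in forests -/

/-- A geodesic from `u` to such a neighbour, extended by the edge to `i`, is again a geodesic, hence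
a path with that neighbour next to last. Paths in a forest are unique. -/
theorem eq_of_adj_of_dist_eq {V : Type*} {G : SimpleGraph V} (hG : G.IsAcyclic) {u i j j' : V}
    (hr : G.Reachable u i) (hj : G.Adj i j) (hj' : G.Adj i j')
    (hd : G.dist u i = G.dist u j + 1) (hd' : G.dist u i = G.dist u j' + 1) : j = j' := by
  have key : ∀ k, G.Adj i k → G.dist u i = G.dist u k + 1 →
      ∃ p : G.Walk u i, p.IsPath ∧ p.penultimate = k := by
    intro k hk hdk
    obtain ⟨p, hp⟩ := (hr.trans hk.reachable).exists_walk_length_eq_dist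
    refine ⟨p.concat hk.symm, ?_, by simp⟩
    refine SimpleGraph.Walk.isPath_of_length_eq_dist _ ?_
    rw [SimpleGraph.Walk.length_concat, hp, hdk]
  obtain ⟨p, hp, rfl⟩ := key j hj hd
  obtain ⟨p', hp', rfl⟩ := key j' hj' hd'
  have := (hG.subsingleton_path u i).elim ⟨p, hp⟩ ⟨p', hp'⟩
  rw [Subtype.mk.injEq] at this
  rw [this]

theorem forestDiam_le {n : ℕ} (G : SimpleGraph (Fin n)) : forestDiam G ≤ n := by
  refine Finset.sup_le fun u _ => Finset.sup_le fun v _ => ?_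
  by_cases h : G.Reachable u v
  · obtain ⟨p, hp, hl⟩ := h.exists_path_of_dist
    rw [← hl]
    simpa using hp.length_lt.le
  · rw [SimpleGraph.dist_eq_zero_of_not_reachable h]
    exact Nat.zero_le _

theorem forestDiam_pos {n : ℕ} {G : SimpleGraph (Fin n)} (hG : G ≠ ⊥) : 1 ≤ forestDiam G := by
  obtain ⟨u, v, h⟩ := SimpleGraph.ne_bot_iff_exists_adj.mp hG
  rw [← SimpleGraph.dist_eq_one_iff_adj.mpr h]
  exact (Finset.le_sup (f := fun v => G.dist u v) (Finset.mem_univ v)).trans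
    (Finset.le_sup (f := fun u => Finset.univ.sup fun v => G.dist u v) (Finset.mem_univ u))

/-- Adjacent vertices share a component and thus a root, so all the depths involved are distances
from one vertex. -/
theorem Problem.Rooting.isChild_unique {n : ℕ} {P : Problem n} (r : P.Rooting)
    (hG : P.graph.IsAcyclic) {i j j' : Fin n} (h : r.IsChild i j) (h' : r.IsChild i j') :
    j = j' := by
  have hroot : ∀ k, P.graph.Adj i k → r.root (P.graph.connectedComponentMk k) =
      r.root (P.graph.connectedComponentMk i) := fun k hk => by
    rw [SimpleGraph.ConnectedComponent.eq.mpr hk.reachable]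
  have hr : P.graph.Reachable (r.root (P.graph.connectedComponentMk i)) i :=
    SimpleGraph.ConnectedComponent.exact (r.root_mem (P.graph.connectedComponentMk i))
  have hd := h.2
  have hd' := h'.2
  unfold Problem.Rooting.depth at hd hd'
  rw [hroot j h.1] at hd
  rw [hroot j' h'.1] at hd'
  exact eq_of_adj_of_dist_eq hG hr h.1 h'.1 hd hd'

/-- If n ≥ K, already K^d ≤ n^d. Otherwise d ≤ n ≤ K, and K^d is bounded in terms of K alone. -/
theorem exists_pow_le_mul_pow (K : ℕ) : ∃ C : ℕ, ∀ d n : ℕ, d ≤ n → K ^ d ≤ C * n ^ d := by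
  refine ⟨(K + 1) ^ K, fun d n hdn => ?_⟩
  rcases le_total K n with h | h
  · exact (Nat.pow_le_pow_left h d).trans (Nat.le_mul_of_pos_left _ (by positivity))
  · rcases Nat.eq_zero_or_pos n with rfl | hn
    · obtain rfl : d = 0 := by omega
      simpa using Nat.one_le_pow K (K + 1) (Nat.succ_pos K)
    · calc K ^ d ≤ (K + 1) ^ d := Nat.pow_le_pow_left (Nat.le_succ K) d
        _ ≤ (K + 1) ^ K := Nat.pow_le_pow_right (Nat.succ_pos K) (hdn.trans h)
        _ ≤ (K + 1) ^ K * n ^ d := Nat.le_mul_of_pos_right _ (pow_pos hn d)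

end MpMap

end

theorem mainTheorem4 :
    ∃ C : ℕ, ∀ (n : ℕ) (P : MpMap.Problem n) (r : P.Rooting) (c q d : ℕ),
      P.graph.IsAcyclic → P.graph ≠ ⊥ → d = MpMap.forestDiam P.graph →
      1 ≤ c → P.SizeLE c → 1 ≤ q → P.DegLE q →
      r.totalPieces ≤ C * (d * c ^ (5 * d + 1) * (2 * n) ^ (d + 1) * q ^ (2 * d)) := by
  classical
  -- The numeral becomes an opaque variable in the algebra below.
  obtain ⟨K, hKdef⟩ : ∃ K : ℕ, K = 2214135 := ⟨_, rfl⟩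
  obtain ⟨C, hC⟩ := MpMap.exists_pow_le_mul_pow K
  refine ⟨16 * C, fun n P r c q d hG hne hd hc hs hq hP => ?_⟩
  have hd1 : 1 ≤ d := hd ▸ MpMap.forestDiam_pos hne
  have hdn : d ≤ n := hd ▸ MpMap.forestDiam_le _
  have hsum := MpMap.sum_forest_le r.depth r.inputPieces r.IsChild (fun i j h => h.2)
    (fun i j j' => r.isChild_unique hG) (D := d) (K := K * (c ^ 5 * q ^ 2)) (v := 4 * c)
    (fun i => hd ▸ r.depth_le_forestDiam i)
    (Nat.mul_pos (by omega) (Nat.mul_pos (pow_pos hc 5) (pow_pos hq 2)))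
    (fun j => by rw [hKdef]; convert r.inputPieces_le hP hq hc hs j)
  rw [Fintype.card_fin] at hsum
  calc r.totalPieces ≤ 2 * ∑ j, r.inputPieces j := r.totalPieces_le
    _ ≤ 2 * ((d + 1) * (n * ((K * (c ^ 5 * q ^ 2)) ^ d * (4 * c)))) :=
        Nat.mul_le_mul_left _ hsum
    -- The existence of an edge gives d ≥ 1, so the number d + 1 of levels is at most 2d.
    _ ≤ 2 * ((2 * d) * (n * ((K * (c ^ 5 * q ^ 2)) ^ d * (4 * c)))) :=
        Nat.mul_le_mul_left _ (Nat.mul_le_mul_right _ (by omega))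
    _ = 16 * (d * c ^ (5 * d + 1) * n * q ^ (2 * d)) * K ^ d := by
        rw [mul_pow, mul_pow, ← pow_mul, ← pow_mul, pow_succ]; ring
    _ ≤ 16 * (d * c ^ (5 * d + 1) * n * q ^ (2 * d)) * (C * n ^ d) :=
        Nat.mul_le_mul_left _ (hC d n hdn)
    _ = 16 * C * (d * c ^ (5 * d + 1) * n ^ (d + 1) * q ^ (2 * d)) := by
        rw [pow_succ n d]; ring
    -- The bound already holds with n in place of 2n.
    _ ≤ 16 * C * (d * c ^ (5 * d + 1) * (2 * n) ^ (d + 1) * q ^ (2 * d)) := by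
        gcongr
        omega
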